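/- Let $\omega>0$ and $\omega'\in i(0,\infty)$, let $\wp,\zeta,\sigma$ be the Weierstrass functions of the lattice $2\omega\mathbb Z+2\omega'\mathbb Z$, and put $\eta=\zeta(\omega)$, $\eta'=\zeta(\omega')$, $T=-2i\omega'>0$. Consider the one-gap potential $\mathcal U(x)=-2\wp(ix+\omega)$, $x\in\mathbb R$, which is $T$-periodic. For $x,\alpha\in\mathbb R$ put $u=ix+\omega$ and $v=\alpha+\omega'$ (so that the energy $\wp(v)$ runs through the lower energy band). The normalized Bloch functions of the lower band are $$\Psi=-\frac{i}{(2\pi)^{1/2}}\Bigl[-\wp(v)-\frac{\eta'}{\omega'}\Bigr]^{-1/2}\frac{\sigma(v-u)}{\sigma(v)\sigma(u)}\exp\{v\eta+(u-\omega)\zeta(v)\},$$ and the quasi-momentum is $$k(v)=\zeta(v)-\frac{\eta'}{\omega'}\,v .$$ The map $\alpha\mapsto k(\alpha+\omega')$ is a bijection of $\mathbb R$ onto $\mathbb R$. Write $v(k)$ for the value of $v=\alpha+\omega'$ with quasi-momentum $k$, and $\Psi(x;k)$ for $\Psi$ at $u=ix+\omega$, $v=v(k)$. For every $x\in\mathbb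 R$ the function $k\mapsto\Psi(x;k)$ is integrable on $[-\pi/T,\pi/T]$. The Wannier function of the lower band, $$W(x)=\Bigl(\frac{T}{2\pi}\Bigr)^{1/2}\int_{-\pi/T}^{\pi/T}\Psi(x;k)\,\mathrm dk,\qquad x\in\mathbb R,$$ is real-valued and even: $$\overline{W(x)}=W(x),\qquad W(-x)=W(x)\qquad\text{for all }x\in\mathbb R .$$ -/

import Mathlib

open Complex

namespace OneGap

noncomputable section

/-- The half-period `ω`; the period lattice of `L` is `2ωℤ + 2ω'ℤ`. -/
def omega (L : PeriodPair) : ℂ := L.ω₁ / 2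

/-- The half-period `ω'`. -/
def omega' (L : PeriodPair) : ℂ := L.ω₂ / 2

/-- The standard rectangular situation `ω ∈ (0, ∞)` and `ω' ∈ i (0, ∞)`, in which the potential
`x ↦ -2 ℘(i x + ω)` is real, smooth and periodic with period `T = -2 i ω' > 0`. -/
structure IsRectangular (L : PeriodPair) : Prop where
  omega_im : (omega L).im = 0
  omega_re_pos : 0 < (omega L).re
  omega'_re : (omega' L).re = 0
  omega'_im_pos : 0 < (omega' L).im

/-- The Weierstrass zeta function
`ζ(z) = 1/z + ∑_{l ≠ 0} (1/(z - l) + 1/l + z/l²)` of the lattice of `L`. -/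
def zeta (L : PeriodPair) (z : ℂ) : ℂ :=
  1 / z + ∑' l : {l : L.lattice // l ≠ 0},
    (1 / (z - (l.1 : ℂ)) + 1 / (l.1 : ℂ) + z / (l.1 : ℂ) ^ 2)

/-- The Weierstrass sigma function
`σ(z) = z ∏_{l ≠ 0} (1 - z/l) exp(z/l + z²/(2 l²))` of the lattice of `L`. -/
def sigma (L : PeriodPair) (z : ℂ) : ℂ :=
  z * ∏' l : {l : L.lattice // l ≠ 0},
    ((1 - z / (l.1 : ℂ)) * exp (z / (l.1 : ℂ) + z ^ 2 / (2 * (l.1 : ℂ) ^ 2)))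

/-- `η = ζ(ω)`. -/
def eta (L : PeriodPair) : ℂ := zeta L (omega L)

/-- `η' = ζ(ω')`. -/
def eta' (L : PeriodPair) : ℂ := zeta L (omega' L)

/-- The spatial period `T = -2 i ω'` (a real number when `ω'` is purely imaginary). -/
def period (L : PeriodPair) : ℝ := (-2 * I * omega' L).re

/-- The point `u = i x + ω` attached to the position `x`. -/
def uPoint (L : PeriodPair) (x : ℝ) : ℂ := I * x + omega L

/-- The spectral point `v = α + ω'`; for real `α` the energy `℘(v)` runs through the
lower (finite) energy band. -/
def vPoint (L : PeriodPair) (α : ℝ) : ℂ := α + omega' L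

/-- The quasi-momentum `k = ζ(v) - (η'/ω') v` at `v = α + ω'`. -/
def quasiMomentum (L : PeriodPair) (α : ℝ) : ℂ :=
  zeta L (vPoint L α) - eta' L / omega' L * vPoint L α

/-- The inverse of `α ↦ k(α + ω')`: the real parameter `α` with quasi-momentum `k`. -/
def alphaOf (L : PeriodPair) (k : ℝ) : ℝ :=
  Function.invFun (fun α : ℝ => quasiMomentum L α) (k : ℂ)

/-- The normalized Bloch function `Ψ(x; α)` of the lower band, as a function of `α`:
`-i (2π)^{-1/2} (-℘(v) - η'/ω')^{-1/2} σ(v-u) / (σ(v) σ(u)) exp(v η + (u - ω) ζ(v))`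
with `u = i x + ω` and `v = α + ω'`. -/
def blochAlpha (L : PeriodPair) (x α : ℝ) : ℂ :=
  -I / (Real.sqrt (2 * Real.pi) : ℂ)
    * (-L.weierstrassP (vPoint L α) - eta' L / omega' L) ^ (-(1 / 2) : ℂ)
    * (sigma L (vPoint L α - uPoint L x) / (sigma L (vPoint L α) * sigma L (uPoint L x)))
    * exp (vPoint L α * eta L + (uPoint L x - omega L) * zeta L (vPoint L α))

/-- The normalized Bloch function `Ψ(x; k)` as a function of the quasi-momentum `k`. -/
def bloch (L : PeriodPair) (x k : ℝ) : ℂ := blochAlpha L x (alphaOf L k)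

/-- The Wannier function `W(x) = (T/2π)^{1/2} ∫_{-π/T}^{π/T} Ψ(x; k) dk`. -/
def wannier (L : PeriodPair) (x : ℝ) : ℂ :=
  (Real.sqrt (period L / (2 * Real.pi)) : ℂ)
    * ∫ k in (-(Real.pi / period L))..(Real.pi / period L), bloch L x k

end

end OneGap

namespace OneGap

open Filter Topology

/-! Reflecting the position and conjugating the Bloch function have the same effect, `α ↦ -α`
(`blochAlpha_neg_left`, `conj_blochAlpha`). The quasi-momentum is odd in `α`, so under the integral
over a symmetric interval both become `k ↦ -k`, which does not change W.

Both symmetries come from the quasi-periodicity of σ and ζ. Position reflection is u ↦ 2ω - u and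
band reflection is v ↦ 2ω' - v; they agree on `blochCore` by Legendre's relation, needed only in the
form `exp_legendre`. Conjugation preserves the rectangular lattice and acts by u ↦ 2ω - u, v ↦ v -
2ω'; the sign this produces is absorbed by the prefactor -i.

The analytic input is the positivity of -℘(v) - η'/ω' (`exists_neg_weierstrassP_sub_eq`), obtained
by summing the lattice series along rows parallel to ω'. It makes the normalizing factor real and
continuous. Being dk/dα, it also makes k strictly increasing; with the additive shift of k under α ↦
α + 2ω this gives a bijection of ℝ with continuous inverse, hence integrability. -/

/-! ### The zeta function: convergence, derivative, quasi-periodicity. -/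

lemma isOpen_compl_lattice (L : PeriodPair) : IsOpen ((L.lattice : Set ℂ)ᶜ) :=
  L.isClosed_lattice.isOpen_compl

lemma isPreconnected_compl_lattice (L : PeriodPair) : IsPreconnected ((L.lattice : Set ℂ)ᶜ) :=
  (Set.Countable.isConnected_compl_of_one_lt_rank (by simp)
    (countable_of_Lindelof_of_discrete (X := L.lattice))).2

/-- The three fractions combine to z² / ((z - l) l²), so the terms decay cubically, which is
summable over a planar lattice. -/
lemma norm_zetaTerm_le {r : ℝ} (hr : 0 < r) {z l : ℂ} (hz : ‖z‖ < r) (hl : 2 * r ≤ ‖l‖) :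
    ‖1 / (z - l) + 1 / l + z / l ^ 2‖ ≤ 2 * r ^ 2 * ‖l‖ ^ (-3 : ℝ) := by
  have hl0 : 0 < ‖l‖ := by linarith
  have h1 : ‖l‖ / 2 ≤ ‖z - l‖ := by
    rw [norm_sub_rev]
    exact .trans (by linarith) (norm_sub_norm_le l z)
  have hzl : z - l ≠ 0 := norm_pos_iff.mp (by linarith)
  have hl' : l ≠ 0 := norm_pos_iff.mp hl0
  have e : 1 / (z - l) + 1 / l + z / l ^ 2 = z ^ 2 / ((z - l) * l ^ 2) := by
    field_simp
    ring
  rw [e, norm_div, norm_mul, norm_pow, norm_pow]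
  calc ‖z‖ ^ 2 / (‖z - l‖ * ‖l‖ ^ 2) ≤ r ^ 2 / (‖l‖ / 2 * ‖l‖ ^ 2) := by gcongr
    _ = 2 * r ^ 2 / ‖l‖ ^ 3 := by field
    _ = _ := by norm_cast

lemma hasSumLocallyUniformly_zetaTerm (L : PeriodPair) :
    HasSumLocallyUniformly
      (fun (l : L.lattice) (z : ℂ) ↦ 1 / (z - l) + 1 / (l : ℂ) + z / (l : ℂ) ^ 2)
      (fun z ↦ ∑' l : L.lattice, (1 / (z - l) + 1 / (l : ℂ) + z / (l : ℂ) ^ 2)) := by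
  refine L.hasSumLocallyUniformly_aux (u := fun r l ↦ 2 * r ^ 2 * ‖l‖ ^ (-3 : ℝ)) _
    (fun _ _ ↦ (ZLattice.summable_norm_rpow _ _ (by simp; norm_num)).mul_left _) fun r hr ↦
    Filter.eventually_atTop.mpr ⟨2 * r, ?_⟩
  rintro _ h s hs l rfl
  exact norm_zetaTerm_le hr hs h

/-- With division by zero equal to zero, the `l = 0` term of the full sum is exactly 1/z. -/
lemma zeta_eq_tsum (L : PeriodPair) (z : ℂ) :
    zeta L z = ∑' l : L.lattice, (1 / (z - l) + 1 / (l : ℂ) + z / (l : ℂ) ^ 2) := by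
  have h := ((hasSumLocallyUniformly_zetaTerm L).hasSum (x := z)).summable
  rw [← h.tsum_subtype_add_tsum_subtype_compl {0}, zeta,
    tsum_singleton (0 : L.lattice)
      (fun l : L.lattice ↦ 1 / (z - l) + 1 / (l : ℂ) + z / (l : ℂ) ^ 2)]
  simp
  rfl

lemma hasSum_zeta (L : PeriodPair) (z : ℂ) :
    HasSum (fun l : L.lattice ↦ 1 / (z - l) + 1 / (l : ℂ) + z / (l : ℂ) ^ 2) (zeta L z) := by
  rw [zeta_eq_tsum]
  exact (hasSumLocallyUniformly_zetaTerm L).hasSum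

lemma hasDerivAt_zetaTerm (L : PeriodPair) {z : ℂ} (hz : z ∉ L.lattice) (l : L.lattice) :
    HasDerivAt (fun z : ℂ ↦ 1 / (z - l) + 1 / (l : ℂ) + z / (l : ℂ) ^ 2)
      (-(1 / (z - l) ^ 2 - 1 / (l : ℂ) ^ 2)) z := by
  have h : z - l ≠ 0 := fun e ↦ hz (by rw [sub_eq_zero.mp e]; exact l.2)
  have := ((((hasDerivAt_id z).sub_const (l : ℂ)).inv h).add_const (1 / (l : ℂ))).add
    ((hasDerivAt_id z).div_const ((l : ℂ) ^ 2))
  refine (this.congr_deriv ?_).congr_of_eventuallyEq (.of_forall fun w ↦ ?_)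
  · simp; ring
  · simp

lemma hasDerivAt_zeta (L : PeriodPair) {z : ℂ} (hz : z ∉ L.lattice) :
    HasDerivAt (zeta L) (-L.weierstrassP z) z := by
  have hU := isOpen_compl_lattice L
  have hd : ∀ s : Finset L.lattice, DifferentiableOn ℂ
      (fun z ↦ ∑ l ∈ s, (1 / (z - l) + 1 / (l : ℂ) + z / (l : ℂ) ^ 2)) (L.lattice : Set ℂ)ᶜ :=
    fun s w hw ↦ (HasDerivAt.fun_sum fun l _ ↦
      hasDerivAt_zetaTerm L hw l).differentiableAt.differentiableWithinAt
  have hf : TendstoLocallyUniformlyOn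
      (fun (s : Finset L.lattice) z ↦ ∑ l ∈ s, (1 / (z - l) + 1 / (l : ℂ) + z / (l : ℂ) ^ 2))
      (zeta L) atTop (L.lattice : Set ℂ)ᶜ := by
    rw [show zeta L = _ from funext (zeta_eq_tsum L)]
    exact (hasSumLocallyUniformly_zetaTerm L).hasSumLocallyUniformlyOn
  have h1 := (hf.deriv (.of_forall hd) hU).tendsto_at hz
  have h2 : HasSum (fun l : L.lattice ↦ -(1 / (z - l) ^ 2 - 1 / (l : ℂ) ^ 2))
      (-L.weierstrassP z) := (L.hasSum_weierstrassP z).neg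
  have h3 : deriv (zeta L) z = -L.weierstrassP z := by
    refine tendsto_nhds_unique h1 (h2.congr fun s ↦ ?_)
    exact ((HasDerivAt.fun_sum fun l _ ↦ hasDerivAt_zetaTerm L hz l).deriv).symm
  rw [← h3]
  exact ((hf.differentiableOn (.of_forall hd) hU).differentiableAt (hU.mem_nhds hz)).hasDerivAt

lemma zeta_neg (L : PeriodPair) (z : ℂ) : zeta L (-z) = -zeta L z := by
  rw [zeta_eq_tsum, zeta_eq_tsum, ← (Equiv.neg L.lattice).tsum_eq, ← tsum_neg]
  congr with l
  simp only [Equiv.neg_apply, NegMemClass.coe_neg]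
  rw [show -z - -(l : ℂ) = -(z - l) by ring]
  simp only [one_div, inv_neg, neg_div, even_two, Even.neg_pow]
  ring

lemma add_mem_lattice_iff (L : PeriodPair) {z l : ℂ} (hl : l ∈ L.lattice) :
    z + l ∈ L.lattice ↔ z ∈ L.lattice :=
  ⟨fun h ↦ by simpa using sub_mem h hl, fun h ↦ add_mem h hl⟩

/-- Quasi-periodicity of the zeta function with respect to the period `2 h`. -/
lemma zeta_add_two_mul (L : PeriodPair) {h : ℂ} (h2 : 2 * h ∈ L.lattice) (h1 : h ∉ L.lattice)
    {z : ℂ} (hz : z ∉ L.lattice) : zeta L (z + 2 * h) = zeta L z + 2 * zeta L h := by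
  have hd : ∀ w ∉ L.lattice, HasDerivAt (fun w ↦ zeta L (w + 2 * h) - zeta L w) 0 w := by
    intro w hw
    have a : HasDerivAt (fun w ↦ zeta L (w + 2 * h)) (-L.weierstrassP (w + 2 * h)) w :=
      (hasDerivAt_zeta L ((add_mem_lattice_iff L h2).not.mpr hw)).comp_add_const w (2 * h)
    refine (a.sub (hasDerivAt_zeta L hw)).congr_deriv ?_
    rw [show L.weierstrassP (w + 2 * h) = L.weierstrassP w from L.weierstrassP_add_coe w ⟨_, h2⟩]
    ring
  have hm : -h ∉ L.lattice := by simpa using h1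
  -- The difference is constant on the connected complement; at -h oddness gives its value 2ζ(h).
  have := (isOpen_compl_lattice L).is_const_of_deriv_eq_zero (isPreconnected_compl_lattice L)
    (fun w hw ↦ (hd w hw).differentiableAt.differentiableWithinAt) (fun w hw ↦ (hd w hw).deriv)
    (x := z) (y := -h) hz hm
  simp only [zeta_neg, show -h + 2 * h = h by ring] at this
  linear_combination this

/-! ### The sigma function: product, zeros, logarithmic derivative, quasi-periodicity. -/

/-- The quadratic Weierstrass elementary factor is cubically close to `1`. -/
lemma norm_elementaryFactor_sub_one_le {w : ℂ} (hw : ‖w‖ ≤ 1 / 2) :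
    ‖(1 - w) * exp (w + w ^ 2 / 2) - 1‖ ≤ 2 * ‖w‖ ^ 3 := by
  have h1 : ‖-w‖ < 1 := by rw [norm_neg]; linarith
  have h := norm_log_sub_logTaylor_le 2 h1
  have ht : logTaylor (2 + 1) (-w) = -(w + w ^ 2 / 2) := by
    simp [logTaylor_succ, logTaylor_zero]
    ring
  have h0 : (1 - w) ≠ 0 := fun e ↦ by
    rw [← sub_eq_zero.mp e] at hw
    norm_num at hw
  rw [ht, sub_neg_eq_add, norm_neg, ← sub_eq_add_neg] at h
  set d := log (1 - w) + (w + w ^ 2 / 2) with hd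
  -- The factor is exp of the second-order Taylor remainder of log(1 - w).
  have he : (1 - w) * exp (w + w ^ 2 / 2) = exp d := by
    rw [hd, exp_add (log (1 - w)), exp_log h0]
  have hi : (1 - ‖w‖)⁻¹ ≤ 2 := inv_le_of_inv_le₀ (by norm_num) (by linarith)
  have hb : ‖d‖ ≤ ‖w‖ ^ 3 := by
    refine h.trans ?_
    have : ‖w‖ ^ 3 * (1 - ‖w‖)⁻¹ ≤ ‖w‖ ^ 3 * 2 := by gcongr
    norm_num
    linarith [pow_nonneg (norm_nonneg w) 3]
  have hc : ‖w‖ ^ 3 ≤ 1 := pow_le_one₀ (norm_nonneg w) (by linarith)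
  rw [he]
  refine (norm_exp_sub_one_le (hb.trans hc)).trans ?_
  linarith

/-- The factors of the Weierstrass product, minus one. -/
noncomputable def sigmaDefect (l z : ℂ) : ℂ :=
  (1 - z / l) * exp (z / l + z ^ 2 / (2 * l ^ 2)) - 1

lemma one_add_sigmaDefect (l z : ℂ) :
    1 + sigmaDefect l z = (1 - z / l) * exp (z / l + z ^ 2 / (2 * l ^ 2)) := by
  simp [sigmaDefect]

lemma norm_sigmaDefect_le {r : ℝ} {z l : ℂ} (hz : ‖z‖ < r) (hl : 2 * r ≤ ‖l‖) :
    ‖sigmaDefect l z‖ ≤ 2 * r ^ 3 * ‖l‖ ^ (-3 : ℝ) := by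
  have hz0 := norm_nonneg z
  have hl0 : 0 < ‖l‖ := by linarith
  have := norm_elementaryFactor_sub_one_le (w := z / l) (by
    rw [norm_div, div_le_iff₀ hl0]; linarith)
  rw [sigmaDefect, show z ^ 2 / (2 * l ^ 2) = (z / l) ^ 2 / 2 by ring]
  refine this.trans ?_
  rw [norm_div]
  calc 2 * (‖z‖ / ‖l‖) ^ 3 ≤ 2 * (r / ‖l‖) ^ 3 := by gcongr
    _ = 2 * r ^ 3 / ‖l‖ ^ 3 := by ring
    _ = _ := by norm_cast

lemma differentiable_sigmaDefect (l : ℂ) : Differentiable ℂ (sigmaDefect l) := by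
  unfold sigmaDefect
  simp only [div_eq_mul_inv]
  fun_prop

lemma summable_lattice_ne_zero (L : PeriodPair) (c : ℝ) :
    Summable fun l : {l : L.lattice // l ≠ 0} ↦ c * ‖(l.1 : ℂ)‖ ^ (-3 : ℝ) :=
  ((ZLattice.summable_norm_rpow L.lattice (-3) (by simp; norm_num)).mul_left c).subtype _

lemma eventually_norm_sigmaDefect_le (L : PeriodPair) (r : ℝ) :
    ∀ᶠ l : {l : L.lattice // l ≠ 0} in cofinite, ∀ z ∈ Metric.ball (0 : ℂ) r,
      ‖sigmaDefect l.1 z‖ ≤ 2 * r ^ 3 * ‖(l.1 : ℂ)‖ ^ (-3 : ℝ) := by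
  have : ∀ᶠ l : L.lattice in cofinite, 2 * r ≤ ‖(l : ℂ)‖ := by
    refine (isCompact_iff_finite.mp (isCompact_closedBall (0 : L.lattice) (2 * r))).subset ?_
    intro l hl
    simp only [Set.mem_compl_iff, Set.mem_ofPred_eq, not_le] at hl
    simpa using hl.le
  filter_upwards [Subtype.val_injective.tendsto_cofinite.eventually this] with l hl z hz
  exact norm_sigmaDefect_le (by simpa using hz) hl

lemma multipliableLocallyUniformlyOn_sigma (L : PeriodPair) (r : ℝ) :
    MultipliableLocallyUniformlyOn
      (fun (l : {l : L.lattice // l ≠ 0}) z ↦ 1 + sigmaDefect l.1 z) (Metric.ball (0 : ℂ) r) :=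
  Summable.multipliableLocallyUniformlyOn_one_add Metric.isOpen_ball
    (summable_lattice_ne_zero L _) (eventually_norm_sigmaDefect_le L r)
    fun _ ↦ (differentiable_sigmaDefect _).continuous.continuousOn

lemma sigma_eq (L : PeriodPair) (z : ℂ) :
    sigma L z = z * ∏' l : {l : L.lattice // l ≠ 0}, (1 + sigmaDefect l.1 z) := by
  simp only [sigma, one_add_sigmaDefect]

lemma differentiable_sigmaProd (L : PeriodPair) :
    Differentiable ℂ fun z ↦ ∏' l : {l : L.lattice // l ≠ 0}, (1 + sigmaDefect l.1 z) := by
  intro z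
  have h := (multipliableLocallyUniformlyOn_sigma L (‖z‖ + 1)).hasProdLocallyUniformlyOn
  refine (TendstoLocallyUniformlyOn.differentiableOn h (.of_forall fun s ↦ ?_)
    Metric.isOpen_ball).differentiableAt (Metric.isOpen_ball.mem_nhds (by simp))
  exact DifferentiableOn.fun_finsetProd fun l _ ↦
    ((differentiable_sigmaDefect _).const_add 1).differentiableOn

lemma differentiable_sigma (L : PeriodPair) : Differentiable ℂ (sigma L) := by
  rw [show sigma L = _ from funext (sigma_eq L)]
  exact differentiable_id.mul (differentiable_sigmaProd L)

lemma one_add_sigmaDefect_ne_zero {l z : ℂ} (hl : l ≠ 0) (h : z ≠ l) :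
    1 + sigmaDefect l z ≠ 0 := by
  rw [one_add_sigmaDefect]
  refine mul_ne_zero (fun e ↦ h ?_) (exp_ne_zero _)
  field_simp at e
  linear_combination -e

lemma summable_norm_sigmaDefect (L : PeriodPair) (z : ℂ) :
    Summable fun l : {l : L.lattice // l ≠ 0} ↦ ‖sigmaDefect l.1 z‖ := by
  refine Summable.of_norm_bounded_eventually
    (summable_lattice_ne_zero L (2 * (‖z‖ + 1) ^ 3)) ?_
  filter_upwards [eventually_norm_sigmaDefect_le L (‖z‖ + 1)] with l hl
  simpa using hl z (by simp)

lemma sigmaProd_ne_zero (L : PeriodPair) {z : ℂ} (hz : z ∉ L.lattice) :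
    ∏' l : {l : L.lattice // l ≠ 0}, (1 + sigmaDefect l.1 z) ≠ 0 :=
  tprod_one_add_ne_zero_of_summable (fun l ↦ one_add_sigmaDefect_ne_zero
    (by simpa using l.2) fun e ↦ hz (e ▸ l.1.2)) (summable_norm_sigmaDefect L z)

lemma sigma_ne_zero (L : PeriodPair) {z : ℂ} (hz : z ∉ L.lattice) : sigma L z ≠ 0 := by
  rw [sigma_eq]
  exact mul_ne_zero (fun e ↦ hz (e ▸ zero_mem _)) (sigmaProd_ne_zero L hz)

lemma sigma_eq_zero (L : PeriodPair) {z : ℂ} (hz : z ∈ L.lattice) : sigma L z = 0 := by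
  by_cases h0 : z = 0
  · simp [h0, sigma]
  rw [sigma, tprod_of_exists_eq_zero ⟨⟨⟨z, hz⟩, by simpa using h0⟩, by simp [h0]⟩, mul_zero]

lemma logDeriv_one_add_sigmaDefect {l z : ℂ} (hl : l ≠ 0) (h : z ≠ l) :
    logDeriv (fun z ↦ 1 + sigmaDefect l z) z = 1 / (z - l) + 1 / l + z / l ^ 2 := by
  have h' : z - l ≠ 0 := sub_ne_zero.mpr h
  have h'' : l - z ≠ 0 := sub_ne_zero.mpr h.symm
  have a : HasDerivAt (fun z : ℂ ↦ 1 - z / l) (-(1 / l)) z :=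
    ((hasDerivAt_id z).div_const l).const_sub 1
  have b : HasDerivAt (fun z : ℂ ↦ z / l + z ^ 2 / (2 * l ^ 2)) (1 / l + z / l ^ 2) z := by
    refine (((hasDerivAt_id z).div_const l).add
      (((hasDerivAt_id z).pow 2).div_const (2 * l ^ 2))).congr_deriv ?_
    simp
    field
  have c := a.mul b.cexp
  simp only [one_add_sigmaDefect]
  rw [logDeriv_apply]
  have cd : deriv (fun z ↦ (1 - z / l) * exp (z / l + z ^ 2 / (2 * l ^ 2))) z = _ := c.deriv
  rw [cd, div_eq_iff]
  · have : 1 - z / l = (l - z) / l := by field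
    rw [this]
    have e : 1 / (z - l) = - (1 / (l - z)) := by rw [← neg_sub, one_div, inv_neg, one_div]
    rw [e]
    field_simp
    ring
  · rw [← one_add_sigmaDefect]; exact one_add_sigmaDefect_ne_zero hl h

/-- Local uniform convergence of the product allows taking logarithmic derivatives factor by factor,
which yields the zeta series. -/
lemma logDeriv_sigma (L : PeriodPair) {z : ℂ} (hz : z ∉ L.lattice) :
    logDeriv (sigma L) z = zeta L z := by
  have hz0 : z ≠ 0 := fun e ↦ hz (e ▸ zero_mem _)
  have hne : ∀ l : {l : L.lattice // l ≠ 0}, z ≠ l.1 := fun l e ↦ hz (e ▸ l.1.2)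
  have hl0 : ∀ l : {l : L.lattice // l ≠ 0}, (l.1 : ℂ) ≠ 0 := fun l ↦ by simpa using l.2
  have hsum : Summable fun l : {l : L.lattice // l ≠ 0} ↦
      logDeriv (fun z ↦ 1 + sigmaDefect l.1 z) z := by
    simp only [fun l ↦ logDeriv_one_add_sigmaDefect (hl0 l) (hne l)]
    exact (hasSum_zeta L z).summable.subtype _
  have hp := logDeriv_tprod_eq_tsum (Metric.isOpen_ball (x := (0 : ℂ)) (ε := ‖z‖ + 1))
    (x := z) (by simp) (fun l ↦ one_add_sigmaDefect_ne_zero (hl0 l) (hne l))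
    (fun l ↦ ((differentiable_sigmaDefect _).const_add 1).differentiableOn) hsum
    (multipliableLocallyUniformlyOn_sigma L (‖z‖ + 1)) (sigmaProd_ne_zero L hz)
  rw [show sigma L = _ from funext (sigma_eq L),
    logDeriv_mul (f := fun z ↦ z) z hz0 (sigmaProd_ne_zero L hz) differentiableAt_id (differentiable_sigmaProd L z),
    hp, logDeriv_id', zeta]
  simp only [fun l ↦ logDeriv_one_add_sigmaDefect (hl0 l) (hne l)]

lemma hasDerivAt_sigma (L : PeriodPair) {z : ℂ} (hz : z ∉ L.lattice) :
    HasDerivAt (sigma L) (zeta L z * sigma L z) z := by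
  refine (differentiable_sigma L z).hasDerivAt.congr_deriv ?_
  rw [← logDeriv_sigma L hz, logDeriv_apply, div_mul_cancel₀ _ (sigma_ne_zero L hz)]

lemma sigma_neg (L : PeriodPair) (z : ℂ) : sigma L (-z) = -sigma L z := by
  let e : {l : L.lattice // l ≠ 0} ≃ {l : L.lattice // l ≠ 0} :=
    (Equiv.neg L.lattice).subtypeEquiv fun l ↦ by simp
  rw [sigma_eq, sigma_eq, ← e.tprod_eq, neg_mul]
  congr 3 with l
  simp [e, sigmaDefect]

/-- Quasi-periodicity of the sigma function with respect to the period `2 h`. -/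
lemma sigma_add_two_mul (L : PeriodPair) {h : ℂ} (h2 : 2 * h ∈ L.lattice) (h1 : h ∉ L.lattice)
    (z : ℂ) : sigma L (z + 2 * h) = -exp (2 * zeta L h * (z + h)) * sigma L z := by
  -- At lattice points both sides vanish; elsewhere division by σ is allowed.
  by_cases hz : z ∈ L.lattice
  · rw [sigma_eq_zero L hz, sigma_eq_zero L (add_mem hz h2), mul_zero]
  have hd : ∀ w ∉ L.lattice, HasDerivAt
      (fun w ↦ sigma L (w + 2 * h) * exp (-(2 * zeta L h * w)) / sigma L w) 0 w := by
    intro w hw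
    have hs := sigma_ne_zero L hw
    have a : HasDerivAt (fun w ↦ sigma L (w + 2 * h))
        (zeta L (w + 2 * h) * sigma L (w + 2 * h)) w :=
      (hasDerivAt_sigma L ((add_mem_lattice_iff L h2).not.mpr hw)).comp_add_const w (2 * h)
    have b : HasDerivAt (fun w ↦ -(2 * zeta L h * w)) (-(2 * zeta L h)) w := by
      simpa using! ((hasDerivAt_id w).const_mul (2 * zeta L h)).neg
    refine ((a.mul b.cexp).div (hasDerivAt_sigma L hw) hs).congr_deriv ?_
    rw [zeta_add_two_mul L h2 h1 hw, div_eq_zero_iff]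
    left
    simp only [Pi.mul_apply]
    ring
  have hm : -h ∉ L.lattice := by simpa using h1
  -- The quotient is constant; evaluating it at -h, where σ(h)/σ(-h) = -1, produces the sign.
  have := (isOpen_compl_lattice L).is_const_of_deriv_eq_zero (isPreconnected_compl_lattice L)
    (fun w hw ↦ (hd w hw).differentiableAt.differentiableWithinAt) (fun w hw ↦ (hd w hw).deriv)
    (x := z) (y := -h) hz hm
  have hs := sigma_ne_zero L hz
  have hs' := sigma_ne_zero L h1
  simp only [sigma_neg, show -h + 2 * h = h by ring] at this
  rw [div_eq_div_iff hs (neg_ne_zero.mpr hs')] at this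
  have h3 : exp (2 * zeta L h * (z + h)) =
      exp (2 * zeta L h * h) * exp (2 * zeta L h * z) := by rw [← exp_add]; ring_nf
  have h4 : exp (-(2 * zeta L h * z)) * exp (2 * zeta L h * z) = 1 := by
    rw [← exp_add]; simp
  have h5 : -(2 * zeta L h * -h) = 2 * zeta L h * h := by ring
  rw [h5] at this
  rw [h3]
  refine mul_right_cancel₀ hs' ?_
  linear_combination (-exp (2 * zeta L h * z)) * this -
    sigma L (z + 2 * h) * sigma L h * h4

/-! ### Half-periods and Legendre's relation. -/

lemma two_mul_omega_mem (L : PeriodPair) : 2 * omega L ∈ L.lattice := by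
  rw [omega, mul_div_cancel₀ _ two_ne_zero]
  exact L.ω₁_mem_lattice

lemma two_mul_omega'_mem (L : PeriodPair) : 2 * omega' L ∈ L.lattice := by
  rw [omega', mul_div_cancel₀ _ two_ne_zero]
  exact L.ω₂_mem_lattice

lemma omega_notMem (L : PeriodPair) : omega L ∉ L.lattice := L.ω₁_div_two_notMem_lattice

lemma omega'_notMem (L : PeriodPair) : omega' L ∉ L.lattice := L.ω₂_div_two_notMem_lattice

lemma omega_add_omega'_notMem (L : PeriodPair) : omega L + omega' L ∉ L.lattice := by
  have := (L.mul_ω₁_add_mul_ω₂_mem_lattice (α := 1 / 2) (β := 1 / 2)).not.mpr (by norm_num)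
  convert! this using 2
  simp [omega, omega']
  ring

/-- The path -(ω + ω'), ω - ω', ω + ω' consists of two period shifts, and its endpoints are
opposite, so oddness determines the value. -/
lemma zeta_omega_add_omega' (L : PeriodPair) :
    zeta L (omega L + omega' L) = eta L + eta' L := by
  have h := omega_add_omega'_notMem L
  have h' : omega L - omega' L ∉ L.lattice := fun e ↦ h (by
    convert! add_mem e (two_mul_omega'_mem L) using 1
    ring)
  have h'' : -(omega L + omega' L) ∉ L.lattice := by rwa [neg_mem_iff]
  have h1 := zeta_add_two_mul L (two_mul_omega_mem L) (omega_notMem L) h''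
  have h2 := zeta_add_two_mul L (two_mul_omega'_mem L) (omega'_notMem L) h'
  rw [show -(omega L + omega' L) + 2 * omega L = omega L - omega' L by ring, zeta_neg] at h1
  rw [show omega L - omega' L + 2 * omega' L = omega L + omega' L by ring] at h2
  rw [eta, eta']
  linear_combination (1 / 2 : ℂ) * h1 + (1 / 2 : ℂ) * h2

/-- Legendre's relation, in exponentiated form. -/
lemma exp_legendre (L : PeriodPair) :
    exp (2 * (eta L * omega' L - eta' L * omega L)) = -1 := by
  have h3 : 2 * (omega L + omega' L) ∈ L.lattice := by
    rw [mul_add]; exact add_mem (two_mul_omega_mem L) (two_mul_omega'_mem L)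
  -- The shift of ω by 2ω + 2ω' is done in one step (`a`) and in two (`c`, then `b`). One step gives
  -- one minus sign, two steps give two; this mismatch is the -1.
  have a := sigma_add_two_mul L h3 (omega_add_omega'_notMem L) (omega L)
  have b := sigma_add_two_mul L (two_mul_omega_mem L) (omega_notMem L) (omega L + 2 * omega' L)
  have c := sigma_add_two_mul L (two_mul_omega'_mem L) (omega'_notMem L) (omega L)
  rw [c, show omega L + 2 * omega' L + 2 * omega L = omega L + 2 * (omega L + omega' L) by ring,
    a, zeta_omega_add_omega', ← eta, ← eta', ← mul_assoc] at b
  have d := mul_right_cancel₀ (sigma_ne_zero L (omega_notMem L)) b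
  rw [neg_mul_neg, ← exp_add, neg_eq_iff_eq_neg] at d
  have e : exp (2 * (eta L * omega' L - eta' L * omega L)) =
      exp (2 * eta L * (omega L + 2 * omega' L + omega L) + 2 * eta' L * (omega L + omega' L)) *
      exp (-(2 * (eta L + eta' L) * (omega L + (omega L + omega' L)))) := by
    rw [← exp_add]; ring_nf
  rw [e, exp_neg, d, inv_neg, mul_neg, mul_inv_cancel₀ (exp_ne_zero _)]

/-! ### Row sums: partial fractions and telescoping series. -/

/-- The partial fraction expansion of `π² / sin²(π z)` in the upper half-plane. -/
lemma tsum_one_div_add_sq {z : ℂ} (hz : 0 < z.im) :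
    ∑' n : ℤ, 1 / (z + n) ^ 2 = (Real.pi : ℂ) ^ 2 / sin (Real.pi * z) ^ 2 := by
  have h := iteratedDerivWithin_cot_pi_mul_eq_mul_tsum_div_pow (k := 1) le_rfl (z := z) hz
  have hs : sin (Real.pi * z) ≠ 0 :=
    sin_pi_mul_ne_zero (UpperHalfPlane.coe_mem_integerComplement ⟨z, hz⟩)
  have hd : HasDerivAt (fun x : ℂ ↦ Real.pi * cot (Real.pi * x))
      (-((Real.pi : ℂ) ^ 2 / sin (Real.pi * z) ^ 2)) z := by
    have hm : HasDerivAt (fun x : ℂ ↦ (Real.pi : ℂ) * x) Real.pi z := by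
      simpa using (hasDerivAt_id z).const_mul (Real.pi : ℂ)
    have := (hm.ccos.div hm.csin hs).const_mul (Real.pi : ℂ)
    refine (this.congr_deriv ?_).congr_of_eventuallyEq (.of_forall fun w ↦ ?_)
    · rw [← neg_div, mul_div_assoc']
      congr 1
      linear_combination (-(Real.pi : ℂ) ^ 2) * sin_sq_add_cos_sq (Real.pi * z)
    · simp [cot]
  rw [iteratedDerivWithin_one, derivWithin_of_isOpen UpperHalfPlane.isOpen_upperHalfPlaneSet hz,
    hd.deriv] at h
  simpa using h.symm

lemma summable_one_div_add_sq (z : ℂ) : Summable fun n : ℤ ↦ 1 / (z + n) ^ 2 := by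
  have := EisensteinSeries.linear_right_summable z 1 (k := 2) le_rfl
  refine this.congr fun n ↦ ?_
  norm_cast
  simp

lemma sin_pi_half_add (y : ℝ) :
    sin (Real.pi * (1 / 2 + I * y)) = (Real.cosh (Real.pi * y) : ℂ) := by
  rw [show (Real.pi : ℂ) * (1 / 2 + I * y) = (Real.pi * y : ℝ) * I + Real.pi / 2 by
    push_cast; ring, sin_add_pi_div_two, cos_mul_I]
  push_cast; rfl

/-- Series of squared reciprocals on the vertical line through `1 / 2`. -/
lemma exists_hasSum_one_div_half_sq (y : ℝ) :
    ∃ r : ℝ, 0 < r ∧ HasSum (fun n : ℤ ↦ 1 / ((1 / 2 + I * y) - n) ^ 2) (r : ℂ) := by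
  have hpos : 0 < Real.pi ^ 2 / Real.cosh (Real.pi * y) ^ 2 :=
    div_pos (pow_pos Real.pi_pos 2) (pow_pos (Real.cosh_pos _) 2)
  -- The expansion is available in the upper half-plane: y < 0 reduces to it by negation, and for y
  -- = 0 the series has positive real terms.
  rcases lt_trichotomy y 0 with hy | rfl | hy
  · refine ⟨_, hpos, ?_⟩
    have h := (summable_one_div_add_sq (-(1 / 2 + I * y))).hasSum
    rw [tsum_one_div_add_sq (by simpa using hy), mul_neg, sin_neg, neg_sq, sin_pi_half_add] at h
    push_cast at h ⊢
    refine h.congr_fun fun n ↦ ?_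
    rw [← neg_sq]; ring_nf
  · have hterm : ∀ n : ℤ, 1 / ((1 / 2 + I * (0 : ℝ)) - n : ℂ) ^ 2 =
        ((1 / ((1 / 2 : ℝ) - n) ^ 2 : ℝ) : ℂ) := fun n ↦ by push_cast; simp
    have hs := (summable_one_div_add_sq (-(1 / 2 + I * (0 : ℝ)))).congr
      (g := fun n : ℤ ↦ ((1 / ((1 / 2 : ℝ) - n) ^ 2 : ℝ) : ℂ)) fun n ↦ by
        rw [← hterm, ← neg_sq]; ring_nf
    simp only [hterm]
    have hs' := summable_ofReal.mp hs
    refine ⟨_, hs'.tsum_pos (fun n ↦ by positivity) 0 (by norm_num), ?_⟩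
    exact hasSum_ofReal.mpr hs'.hasSum
  · refine ⟨_, hpos, ?_⟩
    have h := (summable_one_div_add_sq (1 / 2 + I * y)).hasSum
    rw [tsum_one_div_add_sq (by simpa using hy), sin_pi_half_add] at h
    push_cast at h ⊢
    refine ((Equiv.neg ℤ).hasSum_iff.mpr h).congr_fun fun n ↦ ?_
    simp [sub_eq_add_neg]

lemma hasSum_nat_telescope {g : ℕ → ℂ} {c : ℂ} (hg : Tendsto g atTop (𝓝 c))
    (hs : Summable fun n ↦ g (n + 1) - g n) : HasSum (fun n ↦ g (n + 1) - g n) (c - g 0) := by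
  rw [hs.hasSum_iff_tendsto_nat]
  simp only [Finset.sum_range_sub]
  exact hg.sub_const (g 0)

/-- The two half-line sums leave the boundary terms -g(0) and g(0), which cancel. -/
lemma hasSum_int_telescope {g : ℤ → ℂ} (hg : Tendsto g cofinite (𝓝 0))
    (hs : Summable fun n ↦ g (n + 1) - g n) : HasSum (fun n ↦ g (n + 1) - g n) 0 := by
  have i1 : Function.Injective fun n : ℕ ↦ (n : ℤ) := Nat.cast_injective
  have i2 : Function.Injective fun n : ℕ ↦ -(n : ℤ) := neg_injective.comp i1
  have i3 : Function.Injective fun n : ℕ ↦ -((n : ℤ) + 1) := fun a b h ↦ by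
    simp only at h
    lia
  have hp : Tendsto (fun n : ℕ ↦ g n) atTop (𝓝 0) := by
    rw [← Nat.cofinite_eq_atTop]
    exact hg.comp i1.tendsto_cofinite
  have hm : Tendsto (fun n : ℕ ↦ g (-n)) atTop (𝓝 0) := by
    rw [← Nat.cofinite_eq_atTop]
    exact hg.comp i2.tendsto_cofinite
  have h1 : HasSum (fun n : ℕ ↦ g ((n : ℤ) + 1) - g n) (0 - g 0) := by
    have := hasSum_nat_telescope hp ((hs.comp_injective i1).congr fun n ↦ by simp)
    simpa using this
  have e (n : ℕ) : g (-((n : ℤ) + 1) + 1) - g (-((n : ℤ) + 1)) =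
      -(g (-((n + 1 : ℕ) : ℤ)) - g (-(n : ℤ))) := by
    rw [neg_sub, show -((n : ℤ) + 1) + 1 = -(n : ℤ) by ring, Nat.cast_succ]
  have h2 : HasSum (fun n : ℕ ↦ g (-((n : ℤ) + 1) + 1) - g (-((n : ℤ) + 1))) (-(0 - g 0)) := by
    have h3 : Summable fun n : ℕ ↦ g (-((n + 1 : ℕ) : ℤ)) - g (-(n : ℤ)) :=
      (hs.comp_injective i3).neg.congr fun n ↦ by
        rw [Function.comp_apply, e, neg_neg]
    have := (hasSum_nat_telescope hm h3).neg
    simpa only [e, Nat.cast_zero, neg_zero] using this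
  have := HasSum.of_nat_of_neg_add_one (f := fun n ↦ g (n + 1) - g n) h1 h2
  rwa [add_neg_cancel] at this

/-- The squares are summable, so they tend to zero, and so do the square roots of their norms. -/
lemma tendsto_one_div_linear_cofinite {a c : ℂ} (hc : c ≠ 0) :
    Tendsto (fun n : ℤ ↦ 1 / (a + c * n)) cofinite (𝓝 0) := by
  have h := ((summable_one_div_add_sq (a / c)).tendsto_cofinite_zero.norm.sqrt).mul_const ‖c‖⁻¹
  rw [tendsto_zero_iff_norm_tendsto_zero]
  simp only [norm_zero, Real.sqrt_zero, zero_mul] at h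
  refine h.congr fun n ↦ ?_
  rw [show a + c * n = c * (a / c + n) by field]
  simp [Real.sqrt_sq (norm_nonneg _), mul_comm]

/-! ### Positivity on the lower band. -/

namespace IsRectangular

variable {L : PeriodPair}

lemma omega_eq (hL : IsRectangular L) : omega L = ((omega L).re : ℂ) :=
  Complex.ext (by simp) (by simp [hL.omega_im])

lemma omega'_eq (hL : IsRectangular L) : omega' L = I * ((omega' L).im : ℂ) :=
  Complex.ext (by simp [hL.omega'_re]) (by simp)

lemma omega'_ne_zero (hL : IsRectangular L) : omega' L ≠ 0 := fun e ↦ by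
  have := hL.omega'_im_pos
  simp [e] at this

lemma vPoint_notMem (hL : IsRectangular L) (α : ℝ) : vPoint L α ∉ L.lattice := by
  rw [PeriodPair.mem_lattice]
  rintro ⟨m, n, h⟩
  have h1 : L.ω₁ = 2 * omega L := by rw [omega]; ring
  have h2 : L.ω₂ = 2 * omega' L := by rw [omega']; ring
  rw [h1, h2, vPoint] at h
  have him := congrArg im h
  simp [hL.omega_im] at him
  have : (2 * n : ℝ) = 1 := by
    have hb := hL.omega'_im_pos.ne'
    field_simp at him
    linarith
  norm_cast at this
  omega

/-- On the lower band, the derivative of the quasi-momentum is positive. -/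
lemma exists_neg_weierstrassP_sub_eq (hL : IsRectangular L) (α : ℝ) :
    ∃ s : ℝ, 0 < s ∧ -L.weierstrassP (vPoint L α) - eta' L / omega' L = s := by
  set b := (omega' L).im with hb
  have hb0 : 0 < b := hL.omega'_im_pos
  have hw : omega' L ≠ 0 := hL.omega'_ne_zero
  have hwI : omega' L = I * b := hL.omega'_eq
  -- Writing η' as (ζ(ω') - ζ(-ω'))/2 makes the 1/l² corrections of ℘ and ζ cancel, leaving this
  -- summand.
  let t : ℂ → ℂ := fun l ↦ 1 / (vPoint L α - l) ^ 2 +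
    1 / (2 * omega' L) * (1 / (omega' L - l) + 1 / (omega' L + l))
  have ht : HasSum (fun l : L.lattice ↦ t l)
      (L.weierstrassP (vPoint L α) + eta' L / omega' L) := by
    have h1 := hasSum_zeta L (omega' L)
    have h2 := hasSum_zeta L (-omega' L)
    have h3 := (L.hasSum_weierstrassP (vPoint L α)).add
      ((h1.sub h2).mul_left (1 / (2 * omega' L)))
    rw [zeta_neg, ← eta',
      show 1 / (2 * omega' L) * (eta' L - -eta' L) = eta' L / omega' L by field] at h3
    refine h3.congr_fun fun l ↦ ?_
    have e : 1 / (-omega' L - l) = -(1 / (omega' L + l)) := by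
      rw [← neg_add', one_div, inv_neg, one_div]
    simp only [t, e]
    have : 1 / (2 * omega' L) * (2 * omega' L / (l : ℂ) ^ 2) = 1 / (l : ℂ) ^ 2 := by
      field
    linear_combination -this
  have ht2 : HasSum (fun p : ℤ × ℤ ↦ t (p.1 * L.ω₁ + p.2 * L.ω₂))
      (L.weierstrassP (vPoint L α) + eta' L / omega' L) := by
    refine (L.latticeEquivProd.symm.toEquiv.hasSum_iff.mpr ht).congr_fun fun p ↦ ?_
    simp [← PeriodPair.latticeEquiv_symm_apply]
  -- Chosen so that v - l = 2ω'(1/2 + i y - n) in row m; squaring 2ω' = 2ib gives the factor -4b².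
  let y : ℤ → ℝ := fun m ↦ -(α - 2 * m * (omega L).re) / (2 * b)
  choose r hr hsum using fun m ↦ exists_hasSum_one_div_half_sq (y m)
  have hrow : ∀ m : ℤ, HasSum (fun n : ℤ ↦ t (m * L.ω₁ + n * L.ω₂))
      ((-(r m / (4 * b ^ 2)) : ℝ) : ℂ) := by
    intro m
    have hA : HasSum (fun n : ℤ ↦ 1 / (vPoint L α - (m * L.ω₁ + n * L.ω₂)) ^ 2)
        ((-(r m / (4 * b ^ 2)) : ℝ) : ℂ) := by
      have := (hsum m).mul_left (-(1 / (4 * b ^ 2)) : ℂ)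
      rw [show (-(1 / (4 * b ^ 2)) : ℂ) * r m = ((-(r m / (4 * b ^ 2)) : ℝ) : ℂ) by
        push_cast; ring] at this
      refine this.congr_fun fun n ↦ ?_
      have e : vPoint L α - (m * L.ω₁ + n * L.ω₂) =
          2 * (I * b) * ((1 / 2 + I * y m) - n) := by
        have h1 : L.ω₁ = 2 * omega L := by rw [omega]; ring
        have h2 : L.ω₂ = 2 * omega' L := by rw [omega']; ring
        have hbC : (b : ℂ) ≠ 0 := by exact_mod_cast hb0.ne'
        rw [h1, h2, vPoint, hwI, hL.omega_eq]
        simp only [y]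
        push_cast
        field_simp
        linear_combination ((α : ℂ) - 2 * m * (omega L).re) * I_sq
      rw [e, mul_pow, mul_pow, mul_pow, I_sq]
      simp only [one_div, mul_inv]
      norm_num
    have hB : Summable fun n : ℤ ↦ 1 / (2 * omega' L) *
        (1 / (omega' L - (m * L.ω₁ + n * L.ω₂)) + 1 / (omega' L + (m * L.ω₁ + n * L.ω₂))) :=
      ((ht2.summable.prod_factor m).sub hA.summable).congr fun n ↦ by simp [t]
    have h2 : L.ω₂ = 2 * omega' L := by rw [omega']; ring
    -- The points l - ω' and l + ω' are consecutive in a row of step 2ω', so the zeta part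
    -- telescopes to zero.
    let g : ℤ → ℂ := fun n ↦ 1 / ((m * L.ω₁ - omega' L) + L.ω₂ * n)
    have hg : Tendsto g cofinite (𝓝 0) := tendsto_one_div_linear_cofinite (by
      rw [h2]; exact mul_ne_zero two_ne_zero hw)
    have hgt : ∀ n : ℤ, 1 / (omega' L - (m * L.ω₁ + n * L.ω₂)) +
        1 / (omega' L + (m * L.ω₁ + n * L.ω₂)) = g (n + 1) - g n := by
      intro n
      have e1 : omega' L - (m * L.ω₁ + n * L.ω₂) = -((m * L.ω₁ - omega' L) + L.ω₂ * n) := by ring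
      have e2 : omega' L + (m * L.ω₁ + n * L.ω₂) =
          (m * L.ω₁ - omega' L) + L.ω₂ * ((n + 1 : ℤ) : ℂ) := by
        push_cast; rw [h2]; ring
      rw [e1, e2, one_div, inv_neg, ← one_div]
      simp only [g]
      ring
    have hw2 : (1 / (2 * omega' L)) ≠ 0 := by simp [hw]
    simp only [hgt] at hB
    have hC := (hasSum_int_telescope hg ((summable_mul_left_iff hw2).mp hB)).mul_left
      (1 / (2 * omega' L))
    rw [mul_zero] at hC
    simpa only [t, hgt, add_zero] using hA.add hC
  have hfin := ht2.prod_fiberwise hrow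
  have hfin' : HasSum (fun m ↦ ((r m / (4 * b ^ 2) : ℝ) : ℂ))
      (-L.weierstrassP (vPoint L α) - eta' L / omega' L) := by
    rw [← neg_add']
    exact hfin.neg.congr_fun fun m ↦ by push_cast; ring
  have hS := summable_ofReal.mp hfin'.summable
  have hpos : ∀ m, 0 < r m / (4 * b ^ 2) := fun m ↦ div_pos (hr m) (by positivity)
  exact ⟨_, hS.tsum_pos (fun m ↦ (hpos m).le) 0 (hpos 0),
    hfin'.unique (hasSum_ofReal.mpr hS.hasSum)⟩

end IsRectangular

/-! ### Reflection symmetries of the Bloch function. -/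

/-- The part of the Bloch function that depends on `u` and `v` through zeta and sigma. -/
noncomputable def blochCore (L : PeriodPair) (u v : ℂ) : ℂ :=
  sigma L (v - u) / (sigma L v * sigma L u) * exp (v * eta L + (u - omega L) * zeta L v)

lemma blochAlpha_eq (L : PeriodPair) (x α : ℝ) :
    blochAlpha L x α = -I / (Real.sqrt (2 * Real.pi) : ℂ)
      * (-L.weierstrassP (vPoint L α) - eta' L / omega' L) ^ (-(1 / 2) : ℂ)
      * blochCore L (uPoint L x) (vPoint L α) := by
  rw [blochAlpha, blochCore]
  ring

lemma zeta_sub_two_mul_omega' (L : PeriodPair) {v : ℂ} (hv : v ∉ L.lattice) :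
    zeta L (v - 2 * omega' L) = zeta L v - 2 * eta' L := by
  have h : v - 2 * omega' L ∉ L.lattice := fun e ↦ hv (by
    simpa using add_mem e (two_mul_omega'_mem L))
  have := zeta_add_two_mul L (two_mul_omega'_mem L) (omega'_notMem L) h
  rw [sub_add_cancel, ← eta'] at this
  rw [this]
  ring

lemma sigma_sub_two_mul_omega (L : PeriodPair) (z : ℂ) :
    sigma L (z - 2 * omega L) = -exp (-(2 * eta L * (z - omega L))) * sigma L z := by
  have := sigma_add_two_mul L (h := -omega L)
    (by rw [mul_neg]; exact neg_mem (two_mul_omega_mem L))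
    (by rw [neg_mem_iff]; exact omega_notMem L) z
  rw [zeta_neg, ← eta] at this
  ring_nf at this ⊢
  exact this

lemma sigma_sub_two_mul_omega' (L : PeriodPair) (z : ℂ) :
    sigma L (z - 2 * omega' L) = -exp (-(2 * eta' L * (z - omega' L))) * sigma L z := by
  have := sigma_add_two_mul L (h := -omega' L)
    (by rw [mul_neg]; exact neg_mem (two_mul_omega'_mem L))
    (by rw [neg_mem_iff]; exact omega'_notMem L) z
  rw [zeta_neg, ← eta'] at this
  ring_nf at this ⊢
  exact this

/-- Shared normal form: `blochCore_two_mul_omega'_sub` reaches the same right-hand side from the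
other reflection. -/
lemma blochCore_two_mul_omega_sub (L : PeriodPair) (u v : ℂ) :
    blochCore L (2 * omega L - u) v =
      -(sigma L (v + u) / (sigma L v * sigma L u) *
        exp (-(v * eta L) - (u - omega L) * zeta L v)) := by
  have h1 : sigma L (2 * omega L - u) = exp (-(2 * eta L * (u - omega L))) * sigma L u := by
    rw [← neg_sub, sigma_neg, sigma_sub_two_mul_omega]
    ring
  have h2 : sigma L (v - (2 * omega L - u)) =
      -exp (-(2 * eta L * (v + u - omega L))) * sigma L (v + u) := by
    rw [← sigma_sub_two_mul_omega]
    ring_nf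
  have h3 : exp (-(v * eta L) - (u - omega L) * zeta L v) =
      exp (-(2 * eta L * (v + u - omega L))) * exp (-(-(2 * eta L * (u - omega L)))) *
        exp (v * eta L + (2 * omega L - u - omega L) * zeta L v) := by
    rw [← exp_add, ← exp_add]
    ring_nf
  rw [blochCore, h1, h2, h3, exp_neg (-(2 * eta L * (u - omega L)))]
  ring

lemma blochCore_two_mul_omega'_sub (L : PeriodPair) (u : ℂ) {v : ℂ} (hv : v ∉ L.lattice) :
    blochCore L u (2 * omega' L - v) =
      -(sigma L (v + u) / (sigma L v * sigma L u) *
        exp (-(v * eta L) - (u - omega L) * zeta L v)) := by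
  have h1 : sigma L (2 * omega' L - v) = exp (-(2 * eta' L * (v - omega' L))) * sigma L v := by
    rw [← neg_sub, sigma_neg, sigma_sub_two_mul_omega']
    ring
  have h2 : sigma L (2 * omega' L - v - u) =
      exp (-(2 * eta' L * (v + u - omega' L))) * sigma L (v + u) := by
    rw [show 2 * omega' L - v - u = -(v + u - 2 * omega' L) by ring, sigma_neg,
      sigma_sub_two_mul_omega']
    ring
  have h3 : zeta L (2 * omega' L - v) = 2 * eta' L - zeta L v := by
    rw [← neg_sub, zeta_neg, zeta_sub_two_mul_omega' L hv]
    ring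
  -- The exponents differ from those wanted by exactly Legendre's combination, whose exponential is
  -- -1.
  have h4 : exp (2 * (eta L * omega' L - eta' L * omega L)) *
      exp (-(v * eta L) - (u - omega L) * zeta L v) =
      exp (-(2 * eta' L * (v + u - omega' L))) * exp (-(-(2 * eta' L * (v - omega' L)))) *
        exp ((2 * omega' L - v) * eta L + (u - omega L) * (2 * eta' L - zeta L v)) := by
    rw [← exp_add, ← exp_add, ← exp_add]
    ring_nf
  rw [exp_legendre, exp_neg (-(2 * eta' L * (v - omega' L)))] at h4
  rw [blochCore, h1, h2, h3]
  linear_combination (-sigma L (v + u) / (sigma L v * sigma L u)) * h4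

lemma blochCore_two_mul_omega_sub_sub (L : PeriodPair) (u v : ℂ) :
    blochCore L (2 * omega L - u) (v - 2 * omega' L) =
      -blochCore L u (2 * omega' L - v) := by
  rw [blochCore_two_mul_omega_sub, blochCore, ← neg_sub v (2 * omega' L), zeta_neg, sigma_neg,
    show -(v - 2 * omega' L) - u = -(v - 2 * omega' L + u) by ring, sigma_neg]
  rw [neg_mul (sigma L _), neg_div_neg_eq]
  ring_nf

lemma weierstrassP_vPoint_neg (L : PeriodPair) (α : ℝ) :
    L.weierstrassP (vPoint L (-α)) = L.weierstrassP (vPoint L α) := by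
  have := L.weierstrassP_sub_coe (vPoint L α) ⟨_, two_mul_omega'_mem L⟩
  rw [← this, ← L.weierstrassP_neg]
  congr 1
  simp [vPoint]
  ring

lemma vPoint_neg (L : PeriodPair) (α : ℝ) : vPoint L (-α) = 2 * omega' L - vPoint L α := by
  simp [vPoint]
  ring

lemma uPoint_neg (L : PeriodPair) (x : ℝ) : uPoint L (-x) = 2 * omega L - uPoint L x := by
  simp [uPoint]
  ring

/-! ### Complex conjugation on a rectangular lattice. -/

namespace IsRectangular

open scoped ComplexConjugate

variable {L : PeriodPair}

lemma conj_omega (hL : IsRectangular L) : conj (omega L) = omega L := by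
  rw [hL.omega_eq, conj_ofReal]

lemma conj_omega' (hL : IsRectangular L) : conj (omega' L) = -omega' L := by
  rw [hL.omega'_eq]
  simp

lemma conj_mem_lattice (hL : IsRectangular L) {l : ℂ} (hl : l ∈ L.lattice) :
    conj l ∈ L.lattice := by
  obtain ⟨m, n, rfl⟩ := PeriodPair.mem_lattice.mp hl
  have h1 : L.ω₁ = 2 * omega L := by rw [omega]; ring
  have h2 : L.ω₂ = 2 * omega' L := by rw [omega']; ring
  refine PeriodPair.mem_lattice.mpr ⟨m, -n, ?_⟩
  rw [h1, h2]
  simp [hL.conj_omega, hL.conj_omega', map_ofNat]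

/-- Complex conjugation on a rectangular lattice. -/
def conjLattice (hL : IsRectangular L) : L.lattice ≃ L.lattice where
  toFun l := ⟨conj (l : ℂ), hL.conj_mem_lattice l.2⟩
  invFun l := ⟨conj (l : ℂ), hL.conj_mem_lattice l.2⟩
  left_inv l := by simp
  right_inv l := by simp

@[simp] lemma coe_conjLattice (hL : IsRectangular L) (l : L.lattice) :
    (hL.conjLattice l : ℂ) = conj (l : ℂ) := rfl

lemma zeta_conj (hL : IsRectangular L) (z : ℂ) : zeta L (conj z) = conj (zeta L z) := by
  rw [zeta_eq_tsum, zeta_eq_tsum, conj_tsum, ← hL.conjLattice.tsum_eq]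
  simp

lemma sigma_conj (hL : IsRectangular L) (z : ℂ) : sigma L (conj z) = conj (sigma L z) := by
  let e : {l : L.lattice // l ≠ 0} ≃ {l : L.lattice // l ≠ 0} :=
    hL.conjLattice.subtypeEquiv fun l ↦ by
      rw [not_iff_not, ← Subtype.coe_inj, ← Subtype.coe_inj]
      simp
  rw [sigma_eq, sigma_eq, map_mul, (multipliable_one_add_of_summable
    (summable_norm_sigmaDefect L z)).map_tprod (starRingEnd ℂ) continuous_conj, ← e.tprod_eq]
  congr 3 with l
  simp [e, sigmaDefect, ← exp_conj, map_ofNat]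

lemma conj_eta (hL : IsRectangular L) : conj (eta L) = eta L := by
  rw [eta, ← hL.zeta_conj, hL.conj_omega]

lemma conj_eta' (hL : IsRectangular L) : conj (eta' L) = -eta' L := by
  rw [eta', ← hL.zeta_conj, hL.conj_omega', zeta_neg]

lemma conj_vPoint (hL : IsRectangular L) (α : ℝ) :
    conj (vPoint L α) = vPoint L α - 2 * omega' L := by
  simp [vPoint, hL.conj_omega']
  ring

lemma conj_uPoint (hL : IsRectangular L) (x : ℝ) :
    conj (uPoint L x) = 2 * omega L - uPoint L x := by
  simp [uPoint, hL.conj_omega]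
  ring

lemma conj_blochCore (hL : IsRectangular L) (x α : ℝ) :
    conj (blochCore L (uPoint L x) (vPoint L α)) =
      -blochCore L (uPoint L x) (vPoint L (-α)) := by
  rw [vPoint_neg, ← blochCore_two_mul_omega_sub_sub, ← hL.conj_uPoint, ← hL.conj_vPoint]
  simp only [blochCore, map_mul, map_div₀, map_add, map_sub, ← exp_conj, hL.conj_eta,
    hL.conj_omega, ← hL.zeta_conj, ← hL.sigma_conj]

lemma blochAlpha_neg_left (hL : IsRectangular L) (x α : ℝ) :
    blochAlpha L (-x) α = blochAlpha L x (-α) := by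
  rw [blochAlpha_eq, blochAlpha_eq, weierstrassP_vPoint_neg, uPoint_neg, vPoint_neg,
    blochCore_two_mul_omega_sub, blochCore_two_mul_omega'_sub L _ (hL.vPoint_notMem α)]

/-- The minus sign from `conj_blochCore` cancels against the conjugate of -i; positivity of the base
keeps the power real. -/
lemma conj_blochAlpha (hL : IsRectangular L) (x α : ℝ) :
    conj (blochAlpha L x α) = blochAlpha L x (-α) := by
  obtain ⟨s, hs, h⟩ := hL.exists_neg_weierstrassP_sub_eq α
  have hc : conj ((s : ℂ) ^ (-(1 / 2) : ℂ)) = (s : ℂ) ^ (-(1 / 2) : ℂ) := by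
    rw [show (-(1 / 2) : ℂ) = ((-(1 / 2) : ℝ) : ℂ) by push_cast; rfl, ← ofReal_cpow hs.le,
      conj_ofReal]
  rw [blochAlpha_eq, blochAlpha_eq, weierstrassP_vPoint_neg, h, map_mul, map_mul,
    hL.conj_blochCore, hc, map_div₀, map_neg, conj_I, conj_ofReal]
  ring

/-! ### The quasi-momentum as an odd increasing bijection. -/

lemma conj_quasiMomentum (hL : IsRectangular L) (α : ℝ) :
    conj (quasiMomentum L α) = quasiMomentum L α := by
  have hw := hL.omega'_ne_zero
  simp only [quasiMomentum, map_sub, map_mul, map_div₀, ← hL.zeta_conj, hL.conj_eta',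
    hL.conj_omega', hL.conj_vPoint, zeta_sub_two_mul_omega' L (hL.vPoint_notMem α)]
  field_simp
  ring

lemma quasiMomentum_eq_re (hL : IsRectangular L) (α : ℝ) :
    quasiMomentum L α = ((quasiMomentum L α).re : ℂ) :=
  (conj_eq_iff_re.mp (hL.conj_quasiMomentum α)).symm

lemma quasiMomentum_neg (hL : IsRectangular L) (α : ℝ) :
    quasiMomentum L (-α) = -quasiMomentum L α := by
  have hw := hL.omega'_ne_zero
  rw [quasiMomentum, quasiMomentum, vPoint_neg, ← neg_sub (vPoint L α), zeta_neg,
    zeta_sub_two_mul_omega' L (hL.vPoint_notMem α)]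
  field_simp
  ring

lemma hasDerivAt_quasiMomentum_re (hL : IsRectangular L) (α : ℝ) :
    HasDerivAt (fun α : ℝ ↦ (quasiMomentum L α).re)
      (-L.weierstrassP (vPoint L α) - eta' L / omega' L).re α := by
  have h1 : HasDerivAt (fun z : ℂ ↦ zeta L (z + omega' L) - eta' L / omega' L * (z + omega' L))
      (-L.weierstrassP (vPoint L α) - eta' L / omega' L) α := by
    have a := (hasDerivAt_zeta L (hL.vPoint_notMem α)).comp_add_const (α : ℂ) (omega' L)
    have b := ((hasDerivAt_id (α : ℂ)).add_const (omega' L)).const_mul (eta' L / omega' L)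
    simpa using! a.sub b
  exact h1.real_of_complex

lemma strictMono_quasiMomentum_re (hL : IsRectangular L) :
    StrictMono fun α : ℝ ↦ (quasiMomentum L α).re := by
  refine strictMono_of_deriv_pos fun α ↦ ?_
  obtain ⟨s, hs, h⟩ := hL.exists_neg_weierstrassP_sub_eq α
  rw [(hL.hasDerivAt_quasiMomentum_re α).deriv, h, ofReal_re]
  exact hs

lemma continuous_quasiMomentum_re (hL : IsRectangular L) :
    Continuous fun α : ℝ ↦ (quasiMomentum L α).re :=
  continuous_iff_continuousAt.mpr fun α ↦ (hL.hasDerivAt_quasiMomentum_re α).continuousAt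

lemma quasiMomentum_add_period (hL : IsRectangular L) (α : ℝ) :
    quasiMomentum L (α + 2 * (omega L).re) =
      quasiMomentum L α + (2 * eta L - eta' L / omega' L * (2 * omega L)) := by
  have : vPoint L (α + 2 * (omega L).re) = vPoint L α + 2 * omega L := by
    rw [vPoint, vPoint]
    push_cast
    rw [← hL.omega_eq]
    ring
  rw [quasiMomentum, quasiMomentum, this,
    zeta_add_two_mul L (two_mul_omega_mem L) (omega_notMem L) (hL.vPoint_notMem α), eta]
  ring

lemma surjective_quasiMomentum_re (hL : IsRectangular L) :
    Function.Surjective fun α : ℝ ↦ (quasiMomentum L α).re := by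
  set K : ℝ → ℝ := fun α ↦ (quasiMomentum L α).re with hK
  set p : ℝ := 2 * (omega L).re
  set c : ℝ := (2 * eta L - eta' L / omega' L * (2 * omega L)).re
  have hmono : StrictMono K := hL.strictMono_quasiMomentum_re
  have hp : 0 < p := mul_pos two_pos hL.omega_re_pos
  have hadd : ∀ α, K (α + p) = K α + c := fun α ↦ by
    simp only [hK, p, hL.quasiMomentum_add_period, add_re, c]
  have hneg : ∀ α, K (-α) = -K α := fun α ↦ by simp only [hK, hL.quasiMomentum_neg, neg_re]
  have h0 : K 0 = 0 := by
    have := hneg 0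
    rw [neg_zero] at this
    linarith
  -- The increment over a period is positive by monotonicity alone, so no closed form for it is
  -- needed.
  have hc : 0 < c := by
    have h1 := hadd 0
    have h2 := hmono (show 0 < 0 + p by simpa using hp)
    linarith
  have hn : ∀ n : ℕ, K (n * p) = n * c := fun n ↦ by
    induction n with
    | zero => simpa using h0
    | succ n ih =>
      push_cast
      rw [add_mul, one_mul, hadd, ih]
      ring
  have hub : ∀ b, ∃ a, b ≤ K a := fun b ↦ by
    obtain ⟨n, h⟩ := exists_nat_ge (b / c)
    exact ⟨n * p, by rw [hn]; exact (div_le_iff₀ hc).mp h⟩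
  refine hL.continuous_quasiMomentum_re.surjective
    (tendsto_atTop_atTop_of_monotone hmono.monotone hub)
    (tendsto_atBot_atBot_of_monotone hmono.monotone fun b ↦ ?_)
  obtain ⟨a, ha⟩ := hub (-b)
  exact ⟨-a, (hneg a).trans_le (by linarith)⟩

lemma existsUnique_quasiMomentum_eq (hL : IsRectangular L) (k : ℝ) :
    ∃! α : ℝ, quasiMomentum L α = (k : ℂ) := by
  obtain ⟨α, hα⟩ := hL.surjective_quasiMomentum_re k
  simp only at hα
  refine ⟨α, (hL.quasiMomentum_eq_re α).trans (by rw [hα]), fun β hβ ↦ ?_⟩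
  refine hL.strictMono_quasiMomentum_re.injective ?_
  simp only [hα, hβ, ofReal_re]

lemma quasiMomentum_alphaOf (hL : IsRectangular L) (k : ℝ) :
    quasiMomentum L (alphaOf L k) = k :=
  Function.invFun_eq (hL.existsUnique_quasiMomentum_eq k).exists

lemma alphaOf_neg (hL : IsRectangular L) (k : ℝ) : alphaOf L (-k) = -alphaOf L k := by
  refine (hL.existsUnique_quasiMomentum_eq (-k)).unique (hL.quasiMomentum_alphaOf (-k)) ?_
  rw [hL.quasiMomentum_neg, hL.quasiMomentum_alphaOf, ofReal_neg]

/-! ### Continuity in k and the Wannier function. -/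

/-- An increasing bijection of ℝ is an order isomorphism, so its inverse is continuous. -/
lemma continuous_alphaOf (hL : IsRectangular L) : Continuous (alphaOf L) := by
  let e := hL.strictMono_quasiMomentum_re.orderIsoOfSurjective _ hL.surjective_quasiMomentum_re
  have : alphaOf L = e.symm := by
    funext k
    rw [eq_comm, OrderIso.symm_apply_eq]
    simp [e, hL.quasiMomentum_alphaOf]
  rw [this]
  exact e.symm.continuous

lemma continuous_blochAlpha (hL : IsRectangular L) (x : ℝ) : Continuous (blochAlpha L x) := by
  refine continuous_iff_continuousAt.mpr fun α ↦ ?_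
  have hv := hL.vPoint_notMem α
  have cv : ContinuousAt (vPoint L) α := by unfold vPoint; fun_prop
  have cz : ContinuousAt (fun α ↦ zeta L (vPoint L α)) α :=
    ContinuousAt.comp (f := vPoint L) (hasDerivAt_zeta L hv).continuousAt cv
  have cs : ∀ w, ContinuousAt (fun α ↦ sigma L (vPoint L α - w)) α := fun w ↦
    ContinuousAt.comp (f := fun α ↦ vPoint L α - w) (differentiable_sigma L).continuous.continuousAt
      (cv.sub_const w)
  have cp : ContinuousAt (fun α ↦ L.weierstrassP (vPoint L α)) α :=
    ContinuousAt.comp (f := vPoint L) (L.differentiableOn_weierstrassP.differentiableAt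
      ((isOpen_compl_lattice L).mem_nhds hv)).continuousAt cv
  have cq : ContinuousAt (fun α ↦ (-L.weierstrassP (vPoint L α) - eta' L / omega' L) ^
      (-(1 / 2) : ℂ)) α := by
    refine (cp.neg.sub_const _).cpow continuousAt_const ?_
    -- Positivity keeps the base off the branch cut of the power.
    obtain ⟨s, hs, h⟩ := hL.exists_neg_weierstrassP_sub_eq α
    rw [Pi.neg_apply, h]
    exact ofReal_mem_slitPlane.mpr hs
  have c0 : ContinuousAt (fun α ↦ sigma L (vPoint L α)) α := by simpa using cs 0
  unfold blochAlpha
  simp only [div_mul_eq_div_div]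
  exact ((continuousAt_const.mul cq).mul (((cs _).div c0 (sigma_ne_zero L hv)).div_const _)).mul
    ((cv.mul_const _).add (cz.const_mul _)).cexp

lemma continuous_bloch (hL : IsRectangular L) (x : ℝ) : Continuous (bloch L x) :=
  (hL.continuous_blochAlpha x).comp hL.continuous_alphaOf

lemma bloch_neg_left (hL : IsRectangular L) (x k : ℝ) : bloch L (-x) k = bloch L x (-k) := by
  rw [bloch, bloch, hL.blochAlpha_neg_left, hL.alphaOf_neg]

lemma conj_bloch (hL : IsRectangular L) (x k : ℝ) : conj (bloch L x k) = bloch L x (-k) := by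
  rw [bloch, bloch, hL.conj_blochAlpha, hL.alphaOf_neg]

lemma wannier_neg (hL : IsRectangular L) (x : ℝ) : wannier L (-x) = wannier L x := by
  simp only [wannier, hL.bloch_neg_left]
  rw [intervalIntegral.integral_comp_neg (bloch L x), neg_neg]

lemma conj_wannier (hL : IsRectangular L) (x : ℝ) : conj (wannier L x) = wannier L x := by
  have h : conj (∫ k in (-(Real.pi / period L))..(Real.pi / period L), bloch L x k) =
      ∫ k in (-(Real.pi / period L))..(Real.pi / period L), conj (bloch L x k) := by
    simp only [intervalIntegral, map_sub, integral_conj]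
  rw [wannier, map_mul, conj_ofReal, h]
  simp only [hL.conj_bloch]
  rw [intervalIntegral.integral_comp_neg (bloch L x), neg_neg]

end IsRectangular

end OneGap

theorem mainTheorem4 (L : PeriodPair) (hL : OneGap.IsRectangular L) :
    -- the quasi-momentum is real and `k ↦ v(k)` is well defined as its inverse
    (∀ α : ℝ, (OneGap.quasiMomentum L α).im = 0) ∧
    (∀ k : ℝ, ∃! α : ℝ, OneGap.quasiMomentum L α = (k : ℂ)) ∧
    -- the integral defining the Wannier function exists
    (∀ x : ℝ, IntervalIntegrable (fun k : ℝ => OneGap.bloch L x k) MeasureTheory.volume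
      (-(Real.pi / OneGap.period L)) (Real.pi / OneGap.period L)) ∧
    -- the Wannier function is real-valued and even
    (∀ x : ℝ, (starRingEnd ℂ) (OneGap.wannier L x) = OneGap.wannier L x) ∧
    (∀ x : ℝ, OneGap.wannier L (-x) = OneGap.wannier L x) :=
  ⟨fun α ↦ conj_eq_iff_im.mp (hL.conj_quasiMomentum α), hL.existsUnique_quasiMomentum_eq,
    fun x ↦ (hL.continuous_bloch x).intervalIntegrable _ _, hL.conj_wannier, hL.wannier_neg⟩
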